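/- \textbf{Theorem (optimality of contests).} There are $k$ identical items and $n>k$ agents. Agent $i$ has a private type $\theta_i$, drawn independently of the others from a distribution $F_i$ with a density that is positive on $\Theta_i=[\underline\theta_i,\bar\theta_i]\subset\mathbb{R}_+$, $\underline\theta_i<\bar\theta_i$. An allocation is an element of $X=\{x\in[0,1]^n:\sum_i x_i\le k\}$. Type $\theta_i$ can generate any signal $s_i\in\mathbb{R}_+$ with effort $e(s_i,\theta_i)=\max\{0,s_i-\theta_i\}$, and gets utility $x_i-\eta\,e(s_i,\theta_i)$ when he receives an item with probability $x_i$; here $\eta>0$. All functions are measurable. An \emph{interim allocation--utility pair} $(\boldsymbol Q,\boldsymbol U)$ consists of functions $Q_i,U_i:\Theta_i\to\mathbb{R}$, $i=1,\dots,n$. The pair is \emph{implementable by a general mechanism} if there are a signal recommendation policy $\tilde s:\prod_j\Theta_j\to\Delta(\mathbb{R}_+^n)$ and an allocation rule $p:\prod_j\Theta_j\times\mathbb{R}_+^n\to X$ such that for all $i$ and $\theta_i,\theta_i'\in\Theta_i$ the expected effort below is finite and $$Q_i(\theta_i)=\mathbf{E}_{\theta_{-i}}\mathbf{E}_{s\sim\tilde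 s(\theta_i,\theta_{-i})}[p_i(\theta_i,\theta_{-i},s)],\qquad U_i(\theta_i)=Q_i(\theta_i)-\eta\,\mathbf{E}_{\theta_{-i}}\mathbf{E}_{s\sim\tilde s(\theta_i,\theta_{-i})}[e(s_i,\theta_i)],$$ $$U_i(\theta_i)\ \ge\ \mathbf{E}_{\theta_{-i}}\mathbf{E}_{s\sim\tilde s(\theta_i',\theta_{-i})}\bigl[\max\{0,\;p_i(\theta_i',\theta_{-i},s)-\eta\,e(s_i,\theta_i)\}\bigr].$$ The pair is \emph{implementable by a contest} if there are a contest rule $x:\mathbb{R}_+^n\to X$ and signal strategies $\hat s_i:\Theta_i\to\mathbb{R}_+$ such that for all $i$, $\theta_i\in\Theta_i$ and $s_i'\in\mathbb{R}_+$ $$Q_i(\theta_i)=\mathbf{E}_{\theta_{-i}}[x_i(\hat s_i(\theta_i),\hat s_{-i}(\theta_{-i}))],\qquad U_i(\theta_i)=Q_i(\theta_i)-\eta\,e(\hat s_i(\theta_i),\theta_i),$$ $$U_i(\theta_i)\ \ge\ \mathbf{E}_{\theta_{-i}}[x_i(s_i',\hat s_{-i}(\theta_{-i}))]-\eta\,e(s_i',\theta_i).$$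 Let $(\boldsymbol Q,\boldsymbol U)$ be implementable by a general mechanism. Then there is a pair $(\boldsymbol Q^\dagger,\boldsymbol U^\dagger)$ that is implementable by a contest, with every $Q_i^\dagger$ nondecreasing on $\Theta_i$, such that $$\mathbf{E}_\theta\Bigl[\sum_i\theta_iQ_i^\dagger(\theta_i)\Bigr]\ \ge\ \mathbf{E}_\theta\Bigl[\sum_i\theta_iQ_i(\theta_i)\Bigr],\qquad U_i^\dagger(\theta_i)\ge U_i(\theta_i)\quad\text{for all } i \text{ and } \theta_i\in\Theta_i,$$ and consequently, for every $\alpha\in[0,1]$, $\mathrm{Obj}_\alpha(\boldsymbol Q^\dagger,\boldsymbol U^\dagger)\ge\mathrm{Obj}_\alpha(\boldsymbol Q,\boldsymbol U)$, where $\mathrm{Obj}_\alpha(\boldsymbol Q,\boldsymbol U)=\mathbf{E}_\theta\bigl[\alpha\sum_i\theta_iQ_i(\theta_i)+(1-\alpha)\sum_iU_i(\theta_i)\bigr]$. -/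

import Mathlib

open MeasureTheory ProbabilityTheory Set
open scoped NNReal ENNReal

noncomputable section

/-- The primitives of the model: `k` identical items, `n > k` agents with independent private
types, agent `i`'s type having a density that is positive on the interval `[lo i, hi i]` of
nonnegative reals, and a marginal cost of effort `η > 0`. -/
structure ContestModel (n : ℕ) where
  /-- number of identical items -/
  k : ℕ
  k_lt_n : k < n
  /-- marginal cost of effort -/
  η : ℝ
  η_pos : 0 < η
  /-- lowest type of each agent -/
  lo : Fin n → ℝ
  /-- highest type of each agent -/
  hi : Fin n → ℝ
  lo_nonneg : ∀ i, 0 ≤ lo i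
  lo_lt_hi : ∀ i, lo i < hi i
  /-- density of the type distribution of each agent -/
  density : Fin n → ℝ → ℝ
  measurable_density : ∀ i, Measurable (density i)
  density_pos : ∀ i, ∀ t ∈ Icc (lo i) (hi i), 0 < density i t
  lintegral_density : ∀ i, ∫⁻ t in Icc (lo i) (hi i), ENNReal.ofReal (density i t) = 1

namespace ContestModel

variable {n : ℕ} (M : ContestModel n)

/-- The type space `Θ i = [lo i, hi i]` of agent `i`. -/
def typeSpace (i : Fin n) : Set ℝ := Icc (M.lo i) (M.hi i)

/-- The distribution `F i` of agent `i`'s type, as a measure on `ℝ` carried by `Θ i`. -/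
def typeDist (i : Fin n) : Measure ℝ :=
  (volume.restrict (M.typeSpace i)).withDensity (fun t => ENNReal.ofReal (M.density i t))

instance (i : Fin n) : IsProbabilityMeasure (M.typeDist i) :=
  ⟨by rw [typeDist, withDensity_apply _ MeasurableSet.univ, Measure.restrict_univ]
      exact M.lintegral_density i⟩

/-- The joint distribution of the (independent) types. An expectation over `θ₋ᵢ` with agent `i`'s
type fixed to `t` is written as an integral against this measure of a function of
`Function.update θ i t`. -/
def profileDist : Measure (Fin n → ℝ) := Measure.pi M.typeDist

/-- The set `X` of (randomized) allocations: agent `i` gets an item with probability `x i`. -/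
def allocations : Set (Fin n → ℝ) :=
  {x | (∀ i, 0 ≤ x i ∧ x i ≤ 1) ∧ ∑ i, x i ≤ (M.k : ℝ)}

/-- The effort `(s - t)⁺` needed by type `t` to generate the signal `s`. -/
def effort (s : ℝ≥0) (t : ℝ) : ℝ := max 0 ((s : ℝ) - t)

/-- `(Q, U)` is implementable by a general mechanism. The signal recommendation policy `σ` draws
a profile of signals from a distribution that may depend on the whole report profile, and the
allocation `p` depends on the report profile and on the signal profile. Policies, allocations and
interim rules are functions on `ℝ`-valued profiles; only their values on types matter. -/
def ImplementableByGeneral (Q U : Fin n → ℝ → ℝ) : Prop :=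
  ∃ (σ : Kernel (Fin n → ℝ) (Fin n → ℝ≥0))
    (p : (Fin n → ℝ) → (Fin n → ℝ≥0) → (Fin n → ℝ)),
    IsMarkovKernel σ ∧
    Measurable (fun z : (Fin n → ℝ) × (Fin n → ℝ≥0) => p z.1 z.2) ∧
    (∀ θ s, p θ s ∈ M.allocations) ∧
    -- consistency of the interim allocation
    (∀ i, ∀ t ∈ M.typeSpace i,
      Q i t = ∫ θ, ∫ s, p (Function.update θ i t) s i ∂(σ (Function.update θ i t))
        ∂M.profileDist) ∧
    -- consistency of the interim utility; the expected effort is finite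
    (∀ i, ∀ t ∈ M.typeSpace i,
      ∫⁻ θ, ∫⁻ s, ENNReal.ofReal (effort (s i) t) ∂(σ (Function.update θ i t))
          ∂M.profileDist ≠ ⊤ ∧
      U i t = Q i t - M.η *
        (∫⁻ θ, ∫⁻ s, ENNReal.ofReal (effort (s i) t) ∂(σ (Function.update θ i t))
          ∂M.profileDist).toReal) ∧
    -- incentives: no gain from misreporting `t'` and then following the recommendation or not
    (∀ i, ∀ t ∈ M.typeSpace i, ∀ t' ∈ M.typeSpace i,
      ∫ θ, ∫ s, max 0 (p (Function.update θ i t') s i - M.η * effort (s i) t)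
          ∂(σ (Function.update θ i t')) ∂M.profileDist ≤ U i t)

/-- `(Q, U)` is implementable by a contest: there are a contest rule `x`, mapping signal profiles
to allocations, and signal strategies `σ i`, depending on agent `i`'s own type only, that induce
`(Q, U)` and form an equilibrium. -/
def ImplementableByContest (Q U : Fin n → ℝ → ℝ) : Prop :=
  ∃ (x : (Fin n → ℝ≥0) → (Fin n → ℝ)) (σ : Fin n → ℝ → ℝ≥0),
    Measurable x ∧
    (∀ s, x s ∈ M.allocations) ∧
    (∀ i, Measurable (σ i)) ∧
    -- consistency
    (∀ i, ∀ t ∈ M.typeSpace i,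
      Q i t = ∫ θ, x (Function.update (fun j => σ j (θ j)) i (σ i t)) i ∂M.profileDist) ∧
    (∀ i, ∀ t ∈ M.typeSpace i, U i t = Q i t - M.η * effort (σ i t) t) ∧
    -- incentives
    (∀ i, ∀ t ∈ M.typeSpace i, ∀ s' : ℝ≥0,
      ∫ θ, x (Function.update (fun j => σ j (θ j)) i s') i ∂M.profileDist
        - M.η * effort s' t ≤ U i t)

/-- Expected matching efficiency of an interim allocation. -/
def matchingEfficiency (Q : Fin n → ℝ → ℝ) : ℝ :=
  ∫ θ, ∑ i, θ i * Q i (θ i) ∂M.profileDist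

/-- The principal's objective with weight `α` on matching efficiency. -/
def objective (α : ℝ) (Q U : Fin n → ℝ → ℝ) : ℝ :=
  ∫ θ, (α * ∑ i, θ i * Q i (θ i) + (1 - α) * ∑ i, U i (θ i)) ∂M.profileDist

end ContestModel

end

open MeasureTheory ProbabilityTheory Set Filter Topology unitInterval
open scoped NNReal ENNReal

/-! Let `R i` be the nondecreasing rearrangement of agent `i`'s interim allocation under his type
law, and `V i` the largest nondecreasing `η`-Lipschitz function below `R i`. The contest implements
the pair (`R`, `V`).

Utilities: type `t` who reports `t'` and obeys pays at most `η * max 0 (t' - t)` more than `t'`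
does, so `U i` is nondecreasing and `η`-Lipschitz (`utility_le_add`). It lies below `Q i`, hence
below the rearrangement, hence below `V i` by maximality.

Efficiency: `R i` has the law of the original interim allocation and is nondecreasing, so it
correlates best with the type (`integral_mul_le_integral_mul_of_monotone`).

Contest: type `t` sends the signal at which `V i` reaches `R i t`, and a signal `s` is made to win
with interim probability `V i s`. A deviation to `s'` then yields `V i s' - η * max 0 (s' - t)`,
which is at most `V i t` by the Lipschitz property.

Feasibility: the profile of values `R j (θ j)` has the same law as the profile of original interim
allocations. Given values `q`, redraw each type from its conditional law given its interim
allocation and apply the original ex post allocation; an agent with value `q i` then gets `q i` on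
average. This holds only for almost every value, whereas deviations may reach exceptional ones, so
the rule is corrected on a null set (`integral_correctedAllocation`). -/

/-! ### Probability integral transform -/

/-- The distribution function of an atomless law attains every value strictly between 0 and 1. -/
lemma exists_measure_Iic_eq (μ : Measure ℝ) [IsProbabilityMeasure μ] [NullSingletonClass μ]
    {c : ℝ} (h0 : 0 < c) (h1 : c < 1) : ∃ a, μ (Iic a) = ENNReal.ofReal c := by
  have hcont : Continuous (cdf μ) := by
    refine continuous_iff_continuousAt.2 fun a => ?_
    have h := StieltjesFunction.measure_singleton (cdf μ) a
    rw [measure_cdf, measure_singleton] at h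
    have hle : cdf μ a ≤ Function.leftLim (cdf μ) a := by
      have := ENNReal.ofReal_eq_zero.1 h.symm
      linarith
    rw [(monotone_cdf μ).continuousAt_iff_leftLim_eq_rightLim, StieltjesFunction.rightLim_eq]
    exact le_antisymm ((monotone_cdf μ).leftLim_le le_rfl) hle
  obtain ⟨x, hx⟩ := ((tendsto_cdf_atBot μ).eventually (eventually_lt_nhds h0)).exists
  obtain ⟨y, hy⟩ := ((tendsto_cdf_atTop μ).eventually (eventually_gt_nhds h1)).exists
  obtain ⟨a, ha⟩ := mem_range_of_exists_le_of_exists_ge hcont ⟨x, hx.le⟩ ⟨y, hy.le⟩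
  exact ⟨a, by rw [← ofReal_cdf, ha]⟩

/-- The probability integral transform: under an atomless law, the distribution function is
uniformly distributed. Strict version. -/
lemma le_measure_measure_Iic_lt (μ : Measure ℝ) [IsProbabilityMeasure μ] [NullSingletonClass μ]
    {c : ℝ≥0∞} (hc : c ≤ 1) : c ≤ μ {t | μ (Iic t) < c} := by
  refine le_of_forall_lt fun d hd => ?_
  -- Unlike `c`, the level `e` is strictly between 0 and 1, so the distribution function attains it.
  obtain ⟨e, hde, hec⟩ := exists_between hd
  have he1 : e < 1 := hec.trans_le hc
  have he0 : 0 < e := bot_le.trans_lt hde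
  obtain ⟨a, ha⟩ := exists_measure_Iic_eq μ (ENNReal.toReal_pos he0.ne' he1.ne_top)
    (by simpa using ENNReal.toReal_strict_mono ENNReal.one_ne_top he1)
  rw [ENNReal.ofReal_toReal he1.ne_top] at ha
  refine hde.trans_le (ha ▸ measure_mono fun t ht => ?_)
  exact (measure_mono (Iic_subset_Iic.2 ht)).trans_lt (ha ▸ hec)

/-- The probability integral transform, non-strict version. -/
lemma measure_measure_Iic_le (μ : Measure ℝ) [IsProbabilityMeasure μ] [NullSingletonClass μ]
    (c : ℝ≥0∞) : μ {t | μ (Iic t) ≤ c} ≤ c := by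
  refine le_of_forall_gt fun d hd => ?_
  obtain ⟨e, hce, hed⟩ := exists_between hd
  rcases lt_or_ge e 1 with he1 | he1
  · have he0 : 0 < e := bot_le.trans_lt hce
    obtain ⟨a, ha⟩ := exists_measure_Iic_eq μ (ENNReal.toReal_pos he0.ne' he1.ne_top)
      (by simpa using ENNReal.toReal_strict_mono ENNReal.one_ne_top he1)
    rw [ENNReal.ofReal_toReal he1.ne_top] at ha
    refine lt_of_le_of_lt (measure_mono (t := Iic a) fun t ht => ?_) (ha.trans_lt hed)
    by_contra hat
    exact (hce.trans_le (ha ▸ measure_mono (Iic_subset_Iic.2 (not_le.1 hat).le))).not_ge ht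
  · exact prob_le_one.trans_lt (he1.trans_lt hed)

/-! ### Nondecreasing rearrangement -/

/-- The nondecreasing rearrangement, under the law `μ`, of a function `Q` with values in
`[0, c]`. -/
noncomputable def increasingRearrangement (μ : Measure ℝ) (Q : ℝ → ℝ) (c : ℝ) (t : ℝ) : ℝ :=
  sInf ({q | 0 ≤ q ∧ μ (Iic t) < μ (Q ⁻¹' Iic q)} ∪ {c})

section Rearrangement

variable {μ : Measure ℝ} {Q : ℝ → ℝ} {c : ℝ}

lemma bddBelow_increasingRearrangement (hc : 0 ≤ c) (t : ℝ) :
    BddBelow ({q | 0 ≤ q ∧ μ (Iic t) < μ (Q ⁻¹' Iic q)} ∪ {c}) :=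
  ⟨0, by rintro q (hq | rfl); exacts [hq.1, hc]⟩

lemma increasingRearrangement_le (hc : 0 ≤ c) (t : ℝ) : increasingRearrangement μ Q c t ≤ c :=
  csInf_le (bddBelow_increasingRearrangement hc t) (Or.inr rfl)

lemma increasingRearrangement_nonneg (hc : 0 ≤ c) (t : ℝ) :
    0 ≤ increasingRearrangement μ Q c t :=
  le_csInf ⟨c, Or.inr rfl⟩ (by rintro q (hq | rfl); exacts [hq.1, hc])

lemma monotone_increasingRearrangement (hc : 0 ≤ c) :
    Monotone (increasingRearrangement μ Q c) := fun s _ hst =>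
  csInf_le_csInf (bddBelow_increasingRearrangement hc s) ⟨c, Or.inr rfl⟩ <|
    union_subset_union_left _ fun _ hq =>
      ⟨hq.1, (measure_mono (Iic_subset_Iic.2 hst)).trans_lt hq.2⟩

/-- A nondecreasing function lying below `Q` also lies below the rearrangement of `Q`. -/
lemma le_increasingRearrangement {S : Set ℝ} (hS : ∀ᵐ t ∂μ, t ∈ S) {U : ℝ → ℝ}
    (hU : MonotoneOn U S) (hUQ : ∀ t ∈ S, U t ≤ Q t) (hQc : ∀ t, Q t ≤ c) {t : ℝ} (ht : t ∈ S) :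
    U t ≤ increasingRearrangement μ Q c t := by
  refine le_csInf ⟨c, Or.inr rfl⟩ ?_
  rintro q (hq | rfl)
  -- If `q < U t`, every `s > t` in `S` has `Q s ≥ U s ≥ U t > q`. So up to a null set `{Q ≤ q}`
  -- lies in `Iic t`, against the choice of `q`.
  · by_contra! hlt
    refine hq.2.not_ge (measure_mono_ae ?_)
    filter_upwards [hS] with s hs hsq
    refine mem_Iic.2 (le_of_not_gt fun (hts : t < s) => ?_)
    have h1 := hU ht hs hts.le
    have h2 := hUQ s hs
    have h3 : Q s ≤ q := hsq
    linarith
  · exact (hUQ t ht).trans (hQc t)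

/-- The rearrangement is a quantile function of `Q` evaluated at `μ (Iic t)`, which is uniform
because `μ` has no atoms. Below 0 and from `c` on, the two distribution functions agree trivially.
-/
lemma map_increasingRearrangement [IsProbabilityMeasure μ] [NullSingletonClass μ] (hQ : Measurable Q)
    (h0 : ∀ t, 0 ≤ Q t) (hQc : ∀ t, Q t ≤ c) :
    μ.map (increasingRearrangement μ Q c) = μ.map Q := by
  have hc : 0 ≤ c := (h0 0).trans (hQc 0)
  have hm := (monotone_increasingRearrangement (μ := μ) (Q := Q) hc).measurable
  have := Measure.isProbabilityMeasure_map (μ := μ) hQ.aemeasurable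
  have := Measure.isProbabilityMeasure_map (μ := μ) hm.aemeasurable
  refine Measure.ext_of_Iic _ _ fun q => ?_
  rw [Measure.map_apply hm measurableSet_Iic, Measure.map_apply hQ measurableSet_Iic]
  rcases lt_or_ge q 0 with hq0 | hq0
  · congr 1
    ext t
    simp only [mem_preimage, mem_Iic]
    exact ⟨fun h => absurd (h.trans_lt hq0) (increasingRearrangement_nonneg hc t).not_gt,
      fun h => absurd (h.trans_lt hq0) (h0 t).not_gt⟩
  rcases le_or_gt c q with hqc | hqc
  · congr 1
    ext t
    simp only [mem_preimage, mem_Iic]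
    exact ⟨fun _ => (hQc t).trans hqc, fun _ => (increasingRearrangement_le hc t).trans hqc⟩
  apply le_antisymm
  · refine (measure_mono fun t ht => ?_).trans (measure_measure_Iic_le μ _)
    -- The infimum need not be attained, so the bound is proved at `x > q` and passed to the limit
    -- by right continuity.
    have hlim : Tendsto (fun x => μ (Q ⁻¹' Iic x)) (𝓝[>] q) (𝓝 (μ (Q ⁻¹' Iic q))) := by
      have h1 : ContinuousWithinAt (cdf (μ.map Q)) (Ioi q) q :=
        ((cdf (μ.map Q)).right_continuous q).mono Ioi_subset_Ici_self
      have h2 := (ENNReal.continuous_ofReal.tendsto _).comp h1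
      simpa only [Function.comp_def, ofReal_cdf, Measure.map_apply hQ measurableSet_Iic] using h2
    refine ge_of_tendsto hlim ?_
    filter_upwards [Ioo_mem_nhdsGT hqc] with x hx
    have hlt : increasingRearrangement μ Q c t < x := lt_of_le_of_lt ht hx.1
    obtain ⟨y, hy, hyx⟩ := exists_lt_of_csInf_lt ⟨c, Or.inr rfl⟩ hlt
    rcases hy with hy | rfl
    · exact hy.2.le.trans (measure_mono (preimage_mono (Iic_subset_Iic.2 hyx.le)))
    · exact absurd hyx hx.2.not_gt
  · refine (le_measure_measure_Iic_lt μ prob_le_one).trans (measure_mono fun t ht => ?_)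
    exact csInf_le (bddBelow_increasingRearrangement hc t) (Or.inl ⟨hq0, ht⟩)

end Rearrangement

/-! ### Lipschitz minorant -/

/-- The largest nondecreasing `η`-Lipschitz function below a nondecreasing function `R`. -/
noncomputable def lipschitzMinorant (η : ℝ) (R : ℝ → ℝ) (s : ℝ) : ℝ :=
  ⨅ t, (R t + η * max 0 (s - t))

section Minorant

variable {η : ℝ} {R : ℝ → ℝ}

lemma bddBelow_lipschitzMinorant (hη : 0 ≤ η) (h0 : ∀ t, 0 ≤ R t) (s : ℝ) :
    BddBelow (range fun t => R t + η * max 0 (s - t)) :=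
  ⟨0, by rintro _ ⟨t, rfl⟩; have := h0 t; positivity⟩

lemma lipschitzMinorant_nonneg (hη : 0 ≤ η) (h0 : ∀ t, 0 ≤ R t) (s : ℝ) :
    0 ≤ lipschitzMinorant η R s :=
  le_ciInf fun t => by have := h0 t; positivity

lemma lipschitzMinorant_le (hη : 0 ≤ η) (h0 : ∀ t, 0 ≤ R t) (s : ℝ) :
    lipschitzMinorant η R s ≤ R s :=
  (ciInf_le (bddBelow_lipschitzMinorant hη h0 s) s).trans (by simp)

/-- Triangle inequality for the one-sided distance `max 0 (s - t)`. It contains both monotonicity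
and the Lipschitz bound, and is the incentive constraint of the contest. -/
lemma lipschitzMinorant_le_add (hη : 0 ≤ η) (h0 : ∀ t, 0 ≤ R t) (s t : ℝ) :
    lipschitzMinorant η R s ≤ lipschitzMinorant η R t + η * max 0 (s - t) := by
  rw [← sub_le_iff_le_add]
  refine le_ciInf fun r => sub_le_iff_le_add.2 ?_
  refine (ciInf_le (bddBelow_lipschitzMinorant hη h0 s) r).trans ?_
  rw [add_assoc, ← mul_add]
  gcongr
  have h1 := le_max_left 0 (t - r)
  have h2 := le_max_right 0 (t - r)
  have h3 := le_max_left 0 (s - t)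
  have h4 := le_max_right 0 (s - t)
  exact max_le (by linarith) (by linarith)

lemma monotone_lipschitzMinorant (hη : 0 ≤ η) (h0 : ∀ t, 0 ≤ R t) :
    Monotone (lipschitzMinorant η R) := fun s t hst => by
  simpa [max_eq_left (sub_nonpos.2 hst)] using lipschitzMinorant_le_add hη h0 s t

/-- The signal at which the minorant reaches the value `R t`. -/
lemma lipschitzMinorant_add_div (hη : 0 < η) (h0 : ∀ t, 0 ≤ R t) (hR : Monotone R) (t : ℝ) :
    lipschitzMinorant η R (t + (R t - lipschitzMinorant η R t) / η) = R t := by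
  have hle := lipschitzMinorant_le hη.le h0 t
  have hd : 0 ≤ (R t - lipschitzMinorant η R t) / η := div_nonneg (by linarith) hη.le
  apply le_antisymm
  · refine (lipschitzMinorant_le_add hη.le h0 _ t).trans ?_
    rw [add_sub_cancel_left, max_eq_right hd, mul_div_cancel₀ _ hη.ne']
    linarith
  · refine le_ciInf fun r => ?_
    -- For `r ≥ t`, `R r` alone is at least `R t`. For `r ≤ t`, moving from `t` to the new signal
    -- raises the competitor at `r` by exactly `R t - lipschitzMinorant η R t`.
    rcases le_total t r with h | h
    · have := hR h
      have : 0 ≤ η * max 0 (t + (R t - lipschitzMinorant η R t) / η - r) := by positivity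
      linarith [hR h]
    · have h1 := ciInf_le (bddBelow_lipschitzMinorant hη.le h0 t) r
      rw [max_eq_right (by linarith)] at h1
      rw [max_eq_right (by linarith)]
      have h2 : η * (t + (R t - lipschitzMinorant η R t) / η - r)
          = η * (t - r) + (R t - lipschitzMinorant η R t) := by
        field_simp
        ring
      rw [h2]
      have h3 : lipschitzMinorant η R t ≤ R r + η * (t - r) := h1
      linarith

/-- The infimum runs over all of `ℝ`, but `U` is controlled only on `[a, b]`. Points `r` below `a`
are moved up to `a`, which `hR'` permits; points above `s` are handled by monotonicity of `R`. -/
lemma le_lipschitzMinorant (hη : 0 ≤ η) (hR : Monotone R) {a b : ℝ} {U : ℝ → ℝ}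
    (hU : ∀ s ∈ Icc a b, ∀ t ∈ Icc a b, U s ≤ U t + η * max 0 (s - t))
    (hUR : ∀ t ∈ Icc a b, U t ≤ R t) (hR' : ∀ t ≤ a, R a ≤ R t) {s : ℝ} (hs : s ∈ Icc a b) :
    U s ≤ lipschitzMinorant η R s := by
  refine le_ciInf fun r => ?_
  rcases le_total r s with hrs | hrs
  · have hmem : max a r ∈ Icc a b := ⟨le_max_left _ _, max_le (hs.1.trans hs.2) (hrs.trans hs.2)⟩
    have h1 := hU s hs _ hmem
    have h2 := hUR _ hmem
    have h3 : R (max a r) ≤ R r := by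
      rcases le_total a r with h | h
      · rw [max_eq_right h]
      · rw [max_eq_left h]; exact hR' r h
    have h4 : η * max 0 (s - max a r) ≤ η * max 0 (s - r) := by
      gcongr
      exact le_max_right _ _
    linarith
  · have := hUR s hs
    have := hR hrs
    have : 0 ≤ η * max 0 (s - r) := by positivity
    linarith

end Minorant

/-- Makes the rearrangement constant below the lowest type, as `le_lipschitzMinorant` requires. -/
lemma increasingRearrangement_of_measure_Iic_eq {μ : Measure ℝ} {Q : ℝ → ℝ} {c s t : ℝ}
    (h : μ (Iic s) = μ (Iic t)) :
    increasingRearrangement μ Q c s = increasingRearrangement μ Q c t := by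
  rw [increasingRearrangement, increasingRearrangement, h]

/-! ### Sampling types conditionally on the interim allocation -/

/-- A measurable version of drawing, with the help of a uniform variable, from the conditional law
of `t` given `Q t = q`. -/
lemma exists_conditional_sampler (μ : Measure ℝ) [IsProbabilityMeasure μ] {Q : ℝ → ℝ}
    (hQ : Measurable Q) : ∃ f : ℝ → I → ℝ, Measurable (Function.uncurry f) ∧
      ((μ.map Q).prod volume).map (fun z => (z.1, f z.1 z.2)) = μ.map (fun t => (Q t, t)) := by
  obtain ⟨f, hf, hfκ⟩ := Kernel.exists_measurable_map_eq_unitInterval (condDistrib id Q μ)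
  refine ⟨f, hf, ?_⟩
  have := Measure.isProbabilityMeasure_map (μ := μ) hQ.aemeasurable
  have h := compProd_map_condDistrib (mβ := inferInstance) (X := Q) (μ := μ) (Y := (id : ℝ → ℝ)) aemeasurable_id
  have hm : Measurable fun z : ℝ × I => (z.1, f z.1 z.2) := measurable_fst.prodMk hf
  refine Eq.trans ?_ h
  ext s hs
  rw [Measure.map_apply hm hs, Measure.compProd_apply hs, Measure.prod_apply (hm hs)]
  refine lintegral_congr fun q => ?_
  rw [← hfκ, Measure.map_apply (by fun_prop) (measurable_prodMk_left hs)]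
  rfl

section Sampler

variable {μ : Measure ℝ} {Q : ℝ → ℝ} {f : ℝ → I → ℝ}

lemma map_conditional_sampler (hQ : Measurable Q) (hf : Measurable (Function.uncurry f))
    (h : ((μ.map Q).prod volume).map (fun z => (z.1, f z.1 z.2)) = μ.map (fun t => (Q t, t))) :
    ((μ.map Q).prod volume).map (Function.uncurry f) = μ := by
  have hm : Measurable fun z : ℝ × I => (z.1, f z.1 z.2) := measurable_fst.prodMk hf
  have h2 := congrArg (Measure.map Prod.snd) h
  rw [Measure.map_map measurable_snd hm,
    Measure.map_map measurable_snd (hQ.prodMk measurable_id')] at h2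
  exact h2.trans Measure.map_id

/-- The sampled pair has the law of `(Q t, t)`, which is carried by the set where `Q` of the second
entry equals the first. -/
lemma ae_integral_conditional_sampler [IsProbabilityMeasure μ] (hQ : Measurable Q) (hf : Measurable (Function.uncurry f))
    (h : ((μ.map Q).prod volume).map (fun z => (z.1, f z.1 z.2)) = μ.map (fun t => (Q t, t))) :
    ∀ᵐ q ∂(μ.map Q), ∫ u, Q (f q u) = q := by
  have := Measure.isProbabilityMeasure_map (μ := μ) hQ.aemeasurable
  have hm : Measurable fun z : ℝ × I => (z.1, f z.1 z.2) := measurable_fst.prodMk hf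
  have hset : MeasurableSet {z : ℝ × ℝ | Q z.2 = z.1} :=
    measurableSet_eq_fun (hQ.comp measurable_snd) measurable_fst
  have h1 : ∀ᵐ z ∂(μ.map (fun t => (Q t, t))), Q z.2 = z.1 := by
    rw [ae_map_iff (hQ.prodMk measurable_id').aemeasurable hset]
    simp
  rw [← h, ae_map_iff hm.aemeasurable hset] at h1
  filter_upwards [Measure.ae_ae_of_ae_prod h1] with q hq
  rw [integral_congr_ae hq]
  simp

end Sampler

/-! ### Rearrangement inequality -/

/-- Rearrangement inequality: among the functions with a given law, a nondecreasing one has the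
largest correlation with the identity. -/
theorem integral_mul_le_integral_mul_of_monotone {μ : Measure ℝ} [IsProbabilityMeasure μ]
    {Q R : ℝ → ℝ} (hQ : Measurable Q) (hR : Monotone R) {c : ℝ} (hRc : ∀ t, |R t| ≤ c)
    (h : μ.map R = μ.map Q) {a b : ℝ} (hμ : ∀ᵐ t ∂μ, t ∈ Icc a b) :
    ∫ t, t * Q t ∂μ ≤ ∫ t, t * R t ∂μ := by
  obtain ⟨f, hf, hfQ⟩ := exists_conditional_sampler μ hQ
  have hRm := hR.measurable
  have hm : Measurable fun z : ℝ × I => (z.1, f z.1 z.2) := measurable_fst.prodMk hf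
  have hR1 : Measurable fun z : ℝ × I => R z.1 := hRm.comp measurable_fst
  have hT : Measurable fun z : ℝ × I => f (R z.1) z.2 := hf.comp (hR1.prodMk measurable_snd)
  -- A coupling: `z.1` and `f (R z.1) z.2` both have law `μ`, and `R z.1` is to the second as `Q t`
  -- is to `t`.
  have hRT : (μ.prod (volume : Measure I)).map (fun z => (R z.1, f (R z.1) z.2))
      = μ.map (fun t => (Q t, t)) := by
    rw [← hfQ, ← h, ← Measure.map_id (μ := (volume : Measure I)),
      Measure.map_prod_map _ _ hRm measurable_id, Measure.map_id,
      Measure.map_map hm (hRm.prodMap measurable_id)]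
    rfl
  have hTμ : (μ.prod (volume : Measure I)).map (fun z => f (R z.1) z.2) = μ := by
    have h2 := congrArg (Measure.map Prod.snd) hRT
    rw [Measure.map_map measurable_snd (hR1.prodMk hT),
      Measure.map_map measurable_snd (hQ.prodMk measurable_id')] at h2
    exact h2.trans Measure.map_id
  have hfst : (μ.prod (volume : Measure I)).map Prod.fst = μ := measurePreserving_fst.map_eq
  have hab : ∀ t ∈ Icc a b, |t| ≤ max |a| |b| := fun t ht => abs_le_max_abs_abs ht.1 ht.2
  have hTab : ∀ᵐ z ∂(μ.prod (volume : Measure I)), f (R z.1) z.2 ∈ Icc a b := by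
    rw [← hTμ] at hμ
    exact ae_of_ae_map hT.aemeasurable hμ
  have hfab : ∀ᵐ z ∂(μ.prod (volume : Measure I)), z.1 ∈ Icc a b := by
    rw [← hfst] at hμ
    exact ae_of_ae_map measurable_fst.aemeasurable hμ
  have hii : ∀ x y, IntervalIntegrable R volume x y := fun x y => hR.intervalIntegrable
  have hΦ : Continuous fun x => ∫ y in (0 : ℝ)..x, R y := intervalIntegral.continuous_primitive hii 0
  -- The primitive of the nondecreasing `R` is convex with subgradient `R`. Integrated along the
  -- coupling, the right side vanishes because both points have law `μ`.
  have hsub : ∀ x y, R x * (y - x) ≤ (∫ s in (0 : ℝ)..y, R s) - ∫ s in (0 : ℝ)..x, R s := by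
    intro x y
    rw [intervalIntegral.integral_interval_sub_left (hii _ _) (hii _ _)]
    rcases le_total x y with hxy | hxy
    · calc R x * (y - x) = ∫ _ in x..y, R x := by simp [mul_comm]
        _ ≤ ∫ s in x..y, R s := intervalIntegral.integral_mono_on hxy (by simp) (hii _ _)
            fun s hs => hR hs.1
    · rw [intervalIntegral.integral_symm]
      have : ∫ s in y..x, R s ≤ ∫ _ in y..x, R x :=
        intervalIntegral.integral_mono_on hxy (hii _ _) (by simp) fun s hs => hR hs.2
      simp only [intervalIntegral.integral_const, smul_eq_mul] at this
      linarith
  have hΦb : ∀ t ∈ Icc a b, ‖∫ y in (0 : ℝ)..t, R y‖ ≤ c * max |a| |b| := fun t ht => by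
    refine (intervalIntegral.norm_integral_le_of_norm_le_const fun s _ => hRc s).trans ?_
    rw [sub_zero]
    exact mul_le_mul_of_nonneg_left (hab t ht) ((abs_nonneg _).trans (hRc 0))
  have hΦμ : Integrable (fun x => ∫ y in (0 : ℝ)..x, R y) μ :=
    Integrable.of_bound hΦ.aestronglyMeasurable _ (hμ.mono hΦb)
  have hint : ∀ g : ℝ × I → ℝ, Measurable g → (∀ᵐ z ∂(μ.prod (volume : Measure I)), g z ∈ Icc a b) →
      Integrable (fun z => R z.1 * g z) (μ.prod (volume : Measure I)) := fun g hg hgab => by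
    refine Integrable.of_bound (hR1.mul hg).aestronglyMeasurable
      (c * max |a| |b|) (hgab.mono fun z hz => ?_)
    rw [norm_mul]
    exact mul_le_mul (hRc _) (hab _ hz) (norm_nonneg _) ((abs_nonneg _).trans (hRc 0))
  have e1 : ∫ t, t * Q t ∂μ = ∫ z, R z.1 * f (R z.1) z.2 ∂(μ.prod (volume : Measure I)) := by
    have := integral_map (μ := μ) (φ := fun t => (Q t, t)) (hQ.prodMk measurable_id').aemeasurable
      (f := fun w : ℝ × ℝ => w.1 * w.2) (by fun_prop)
    rw [← hRT, integral_map (hR1.prodMk hT).aemeasurable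
      (show Measurable fun w : ℝ × ℝ => w.1 * w.2 by fun_prop).aestronglyMeasurable] at this
    rw [this]
    exact integral_congr_ae (ae_of_all _ fun t => mul_comm _ _)
  have e2 : ∫ t, t * R t ∂μ = ∫ z, R z.1 * z.1 ∂(μ.prod (volume : Measure I)) := by
    conv_lhs => rw [← hfst]
    rw [integral_map measurable_fst.aemeasurable
      (show Measurable fun t => t * R t by fun_prop).aestronglyMeasurable]
    exact integral_congr_ae (ae_of_all _ fun t => mul_comm _ _)
  have i1 := hΦμ
  rw [← hTμ] at i1
  replace i1 := i1.comp_measurable hT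
  have i2 := hΦμ
  rw [← hfst] at i2
  replace i2 := i2.comp_measurable measurable_fst
  have e3 : ∫ z, (∫ y in (0 : ℝ)..(f (R z.1) z.2), R y) ∂(μ.prod (volume : Measure I))
      = ∫ z, (∫ y in (0 : ℝ)..z.1, R y) ∂(μ.prod (volume : Measure I)) := by
    rw [← integral_map (f := fun x => ∫ y in (0 : ℝ)..x, R y) hT.aemeasurable
      hΦ.aestronglyMeasurable, hTμ]
    conv_lhs => rw [← hfst]
    rw [integral_map measurable_fst.aemeasurable hΦ.aestronglyMeasurable]
  rw [e1, e2, ← sub_nonpos, ← integral_sub (hint _ hT hTab) (hint _ measurable_fst hfab)]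
  refine (integral_mono ((hint _ hT hTab).sub (hint _ measurable_fst hfab)) (i1.sub i2)
    fun z => ?_).trans_eq ((integral_sub i1 i2).trans (sub_eq_zero.2 e3))
  have := hsub z.1 (f (R z.1) z.2)
  simp only [Pi.sub_apply, Function.comp_apply]
  linarith

/-! ### Redrawing a coordinate of a product law -/

lemma measurable_update_uncurry {ι α : Type*} [DecidableEq ι] [MeasurableSpace α] (i : ι) :
    Measurable fun z : α × (ι → α) => Function.update z.2 i z.1 :=
  measurable_pi_lambda _ fun j => by
    rcases eq_or_ne j i with rfl | h
    · simpa using measurable_fst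
    · simpa [h, Function.comp_def] using (measurable_pi_apply j).comp measurable_snd

/-- Redrawing coordinate `i` of a product law from `lam`. -/
lemma map_update_prod_pi {ι : Type*} [Fintype ι] [DecidableEq ι] {α : Type*} [MeasurableSpace α]
    (μ : ι → Measure α) [∀ i, IsProbabilityMeasure (μ i)] (i : ι) (lam : Measure α)
    [IsProbabilityMeasure lam] :
    (lam.prod (Measure.pi μ)).map (fun z => Function.update z.2 i z.1)
      = Measure.pi (Function.update μ i lam) := by
  have hprob : ∀ j, IsProbabilityMeasure (Function.update μ i lam j) := fun j => by
    rcases eq_or_ne j i with rfl | h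
    · simpa
    · simpa [h] using inferInstanceAs (IsProbabilityMeasure (μ j))
  have hm := measurable_update_uncurry (α := α) i
  refine (Measure.pi_eq fun s hs => ?_).symm
  rw [Measure.map_apply hm (.univ_pi hs)]
  have : (fun z : α × (ι → α) => Function.update z.2 i z.1) ⁻¹' univ.pi s
      = s i ×ˢ univ.pi (Function.update s i univ) := by
    ext ⟨t, θ⟩
    simp only [mem_preimage, Set.mem_pi, mem_univ, true_imp_iff, mem_prod]
    constructor
    · intro h
      refine ⟨by simpa using h i, fun j => ?_⟩
      rcases eq_or_ne j i with rfl | hj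
      · simp
      · simpa [hj] using h j
    · rintro ⟨h1, h2⟩ j
      rcases eq_or_ne j i with rfl | hj
      · simpa using h1
      · simpa [hj] using h2 j
  rw [this, Measure.prod_prod, Measure.pi_pi, ← Finset.mul_prod_erase _ _ (Finset.mem_univ i),
    ← Finset.mul_prod_erase _ (fun j => Function.update μ i lam j (s j)) (Finset.mem_univ i)]
  simp only [Function.update_self, measure_univ, one_mul]
  congr 1
  refine Finset.prod_congr rfl fun j hj => ?_
  have hj' := Finset.ne_of_mem_erase hj
  simp [hj']

/-! ### Allocation by resampled types -/

section Resampling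

variable {ι : Type*} [Fintype ι] {P : (ι → ℝ) → ι → ℝ} {f : ι → ℝ → I → ℝ}

/-- Ex post allocation when the type of each agent `j` is resampled by `f j` from `q j`. -/
noncomputable def resampledAllocation (P : (ι → ℝ) → ι → ℝ) (f : ι → ℝ → I → ℝ) (q : ι → ℝ)
    (i : ι) : ℝ :=
  ∫ u : ι → I, P (fun j => f j (q j) (u j)) i

lemma measurable_resampledAllocation (hP : Measurable P)
    (hf : ∀ i, Measurable (Function.uncurry (f i))) (i : ι) :
    Measurable fun q => resampledAllocation P f q i := by
  have h : Measurable fun z : (ι → ℝ) × (ι → I) => P (fun j => f j (z.1 j) (z.2 j)) i := by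
    refine (measurable_pi_apply i).comp (hP.comp (measurable_pi_lambda _ fun j => ?_))
    have h : Measurable fun z : (ι → ℝ) × (ι → I) => (z.1 j, z.2 j) := by fun_prop
    exact (hf j).comp h
  exact h.stronglyMeasurable.integral_prod_right.measurable

variable [DecidableEq ι]

/-- Interim allocation of agent `i` with type `t` under the ex post allocation `P`. -/
noncomputable def interimAllocation (μ : ι → Measure ℝ) (P : (ι → ℝ) → ι → ℝ) (i : ι) (t : ℝ) : ℝ :=
  ∫ θ, P (Function.update θ i t) i ∂(Measure.pi μ)

/-- The values `q` at which resampling yields the interim allocation `q` exactly. -/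
def exactValues (μ : ι → Measure ℝ) (P : (ι → ℝ) → ι → ℝ) (f : ι → ℝ → I → ℝ) (i : ι) : Set ℝ :=
  {q | ∫ u, interimAllocation μ P i (f i q u) = q}

open Classical in
/-- The resampled allocation, corrected on a null set so as to give each agent `i` the interim
allocation `q i` (truncated to `[0, c]`) whatever `q i` is. -/
noncomputable def correctedAllocation (μ : ι → Measure ℝ) (P : (ι → ℝ) → ι → ℝ)
    (f : ι → ℝ → I → ℝ) (c : ℝ) (q : ι → ℝ) (i : ι) : ℝ :=
  if ∀ j, j ≠ i → q j ∈ exactValues μ P f j then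
    if q i ∈ exactValues μ P f i then resampledAllocation P f q i else max 0 (min c (q i))
  else 0

variable {μ : ι → Measure ℝ}

/-- If all values are exact, this is an average of feasible allocations. Otherwise only one agent
can receive anything, and the truncation at `min 1 k` keeps that feasible. -/
lemma correctedAllocation_mem {k : ℝ} (hk : 0 ≤ k) (hP : Measurable P)
    (hf : ∀ i, Measurable (Function.uncurry (f i))) (h0 : ∀ θ i, 0 ≤ P θ i)
    (h1 : ∀ θ i, P θ i ≤ 1) (hsum : ∀ θ, ∑ i, P θ i ≤ k) (q : ι → ℝ) :
    (∀ i, 0 ≤ correctedAllocation μ P f (min 1 k) q i ∧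
      correctedAllocation μ P f (min 1 k) q i ≤ 1) ∧
    ∑ i, correctedAllocation μ P f (min 1 k) q i ≤ k := by
  classical
  have hc : 0 ≤ min 1 k := le_min zero_le_one hk
  have hm : ∀ i, Measurable fun u : ι → I => P (fun j => f j (q j) (u j)) i := fun i =>
    (measurable_pi_apply i).comp (hP.comp (measurable_pi_lambda _ fun j =>
      (hf j).comp (measurable_const.prodMk (measurable_pi_apply j))))
  have hint : ∀ i, Integrable (fun u : ι → I => P (fun j => f j (q j) (u j)) i) := fun i =>
    Integrable.of_bound (hm i).aestronglyMeasurable 1 (ae_of_all _ fun u => by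
      rw [Real.norm_of_nonneg (h0 _ _)]; exact h1 _ _)
  have hr0 : ∀ i, 0 ≤ resampledAllocation P f q i := fun i => integral_nonneg fun u => h0 _ _
  have hr1 : ∀ i, resampledAllocation P f q i ≤ 1 := fun i => by
    refine (integral_mono (hint i) (integrable_const 1) fun u => h1 _ _).trans ?_
    simp
  have hrs : ∑ i, resampledAllocation P f q i ≤ k := by
    simp only [resampledAllocation]
    rw [← integral_finsetSum _ fun i _ => hint i]
    refine (integral_mono (integrable_finsetSum _ fun i _ => hint i) (integrable_const k)
      fun u => hsum _).trans ?_
    simp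
  have hclip : ∀ x : ℝ, 0 ≤ max 0 (min (min 1 k) x) ∧ max 0 (min (min 1 k) x) ≤ min 1 k :=
    fun x => ⟨le_max_left _ _, max_le hc (min_le_left _ _)⟩
  refine ⟨fun i => ?_, ?_⟩
  · unfold correctedAllocation
    split_ifs
    · exact ⟨hr0 i, hr1 i⟩
    · exact ⟨(hclip _).1, (hclip _).2.trans (min_le_left _ _)⟩
    · exact ⟨le_rfl, zero_le_one⟩
  · by_cases hall : ∀ j, q j ∈ exactValues μ P f j
    · refine le_trans (le_of_eq (Finset.sum_congr rfl fun i _ => ?_)) hrs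
      rw [correctedAllocation, if_pos fun j _ => hall j, if_pos (hall i)]
    · push Not at hall
      obtain ⟨j, hj⟩ := hall
      rw [Finset.sum_eq_single j]
      · rw [correctedAllocation]
        split_ifs
        · exact (hclip _).2.trans (min_le_right _ _)
        · exact hk
      · intro i _ hij
        rw [correctedAllocation, if_neg fun h => hj (h j hij.symm)]
      · simp

variable [∀ i, IsProbabilityMeasure (μ i)]

lemma measurable_interimAllocation (hP : Measurable P) (i : ι) :
    Measurable (interimAllocation μ P i) := by
  have h : Measurable fun z : ℝ × (ι → ℝ) => P (Function.update z.2 i z.1) i :=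
    (measurable_pi_apply i).comp (hP.comp (measurable_update_uncurry i))
  exact h.stronglyMeasurable.integral_prod_right.measurable

lemma measurableSet_exactValues (hP : Measurable P) (hf : ∀ i, Measurable (Function.uncurry (f i)))
    (i : ι) : MeasurableSet (exactValues μ P f i) :=
by
  have h : Measurable fun z : ℝ × I => interimAllocation μ P i (f i z.1 z.2) :=
    (measurable_interimAllocation hP i).comp (hf i)
  exact measurableSet_eq_fun h.stronglyMeasurable.integral_prod_right.measurable measurable_id

lemma measurable_correctedAllocation (hP : Measurable P)
    (hf : ∀ i, Measurable (Function.uncurry (f i))) (c : ℝ) :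
    Measurable (correctedAllocation μ P f c) := by
  classical
  have hE : ∀ j, MeasurableSet {q : ι → ℝ | q j ∈ exactValues μ P f j} := fun j =>
    measurable_pi_apply j (measurableSet_exactValues hP hf j)
  refine measurable_pi_lambda _ fun i => Measurable.ite ?_ (Measurable.ite (hE i) ?_ ?_) ?_
  · have : {q : ι → ℝ | ∀ j, j ≠ i → q j ∈ exactValues μ P f j}
        = ⋂ j, ⋂ _ : j ≠ i, {q | q j ∈ exactValues μ P f j} := by
      ext q; simp
    rw [this]
    exact MeasurableSet.iInter fun j => MeasurableSet.iInter fun _ => hE j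
  · exact measurable_resampledAllocation hP hf i
  · fun_prop
  · exact measurable_const

/-- Each agent's interim allocation under the corrected allocation is exactly his `q i`. -/
theorem integral_correctedAllocation (hP : Measurable P)
    (hf : ∀ i, Measurable (Function.uncurry (f i))) (h0 : ∀ θ i, 0 ≤ P θ i)
    (h1 : ∀ θ i, P θ i ≤ 1)
    (hfμ : ∀ i, (((μ i).map (interimAllocation μ P i)).prod volume).map
      (fun z => (z.1, f i z.1 z.2)) = (μ i).map (fun t => (interimAllocation μ P i t, t)))
    {c r : ℝ} (hr0 : 0 ≤ r) (hrc : r ≤ c) (i : ι) :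
    ∫ q, correctedAllocation μ P f c (Function.update q i r) i
      ∂(Measure.pi fun j => (μ j).map (interimAllocation μ P j)) = r := by
  classical
  have hQ := fun j => measurable_interimAllocation (μ := μ) hP j
  have hprob : ∀ j, IsProbabilityMeasure ((μ j).map (interimAllocation μ P j)) := fun j =>
    Measure.isProbabilityMeasure_map (hQ j).aemeasurable
  have hex : ∀ᵐ q ∂(Measure.pi fun j => (μ j).map (interimAllocation μ P j)),
      ∀ j, q j ∈ exactValues μ P f j := by
    rw [ae_all_iff]
    intro j
    have h := ae_integral_conditional_sampler (hQ j) (hf j) (hfμ j)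
    exact (measurePreserving_eval (fun j => (μ j).map (interimAllocation μ P j)) j
      ).quasiMeasurePreserving.ae h
  -- The other agents' values are almost surely exact. If `r` is not, the agent is simply handed
  -- `r`, and `0 ≤ r ≤ c` makes the truncation void.
  by_cases hr : r ∈ exactValues μ P f i
  swap
  · have : ∀ᵐ q ∂(Measure.pi fun j => (μ j).map (interimAllocation μ P j)),
        correctedAllocation μ P f c (Function.update q i r) i = r := by
      filter_upwards [hex] with q hq
      rw [correctedAllocation, if_pos fun j hj => by simpa [hj] using hq j, Function.update_self,
        if_neg hr, min_eq_right hrc, max_eq_right hr0]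
    rw [integral_congr_ae this]
    simp
  have h2 : ∀ᵐ q ∂(Measure.pi fun j => (μ j).map (interimAllocation μ P j)),
      correctedAllocation μ P f c (Function.update q i r) i
        = resampledAllocation P f (Function.update q i r) i := by
    filter_upwards [hex] with q hq
    rw [correctedAllocation, if_pos fun j hj => by simpa [hj] using hq j, Function.update_self,
      if_pos hr]
  rw [integral_congr_ae h2]
  set ν : ι → Measure ℝ := fun j => (μ j).map (interimAllocation μ P j) with hν
  -- Agent `i` is redrawn from `f i r` whatever `q i` is, while averaging over `q j` and `u j`
  -- restores the law `μ j` of every other agent.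
  set g : ι → ℝ × I → ℝ := fun j z => if j = i then f i r z.2 else f j z.1 z.2 with hg
  have hgm : ∀ j, Measurable (g j) := fun j => by
    rcases eq_or_ne j i with rfl | h
    · simpa [hg, Function.comp_def, Function.uncurry] using
        (hf j).comp (measurable_const.prodMk measurable_snd)
    · simpa [hg, h, Function.uncurry_def] using hf j
  have hfr : Measurable (f i r) := (hf i).comp (measurable_const.prodMk measurable_id)
  have hlam : IsProbabilityMeasure ((volume : Measure I).map (f i r)) :=
    Measure.isProbabilityMeasure_map hfr.aemeasurable
  have hgμ : ∀ j, ((ν j).prod (volume : Measure I)).map (g j)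
      = Function.update μ i ((volume : Measure I).map (f i r)) j := fun j => by
    rcases eq_or_ne j i with rfl | h
    · have : g j = f j r ∘ Prod.snd := by ext z; simp [hg]
      rw [this, ← Measure.map_map hfr measurable_snd, measurePreserving_snd.map_eq]
      simp
    · have : g j = Function.uncurry (f j) := by ext z; simp [hg, h, Function.uncurry]
      rw [this, map_conditional_sampler (hQ j) (hf j) (hfμ j)]
      simp [h]
  have hprob' : ∀ j, IsProbabilityMeasure (((ν j).prod (volume : Measure I)).map (g j)) :=
    fun j => Measure.isProbabilityMeasure_map (hgm j).aemeasurable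
  have hPi : Measurable fun θ => P θ i := (measurable_pi_apply i).comp hP
  have hPint : ∀ {α : Type _} [MeasurableSpace α] (m : Measure α) [IsProbabilityMeasure m]
      (T : α → ι → ℝ), Measurable T → Integrable (fun a => P (T a) i) m :=
    fun m _ T hT => Integrable.of_bound (hPi.comp hT).aestronglyMeasurable 1
      (ae_of_all _ fun a => by rw [Real.norm_of_nonneg (h0 _ _)]; exact h1 _ _)
  have hG : Measurable fun z : (ι → ℝ) × (ι → I) => fun j => g j (z.1 j, z.2 j) :=
    measurable_pi_lambda _ fun j => (hgm j).comp
      (((measurable_pi_apply j).comp measurable_fst).prodMk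
        ((measurable_pi_apply j).comp measurable_snd))
  have hlaw : ((Measure.pi ν).prod (volume : Measure (ι → I))).map
      (fun z j => g j (z.1 j, z.2 j))
      = Measure.pi (Function.update μ i ((volume : Measure I).map (f i r))) := by
    rw [volume_pi, ← measurePreserving_arrowProdEquivProdArrow ℝ I ι ν (fun _ => volume)
      |>.map_eq, Measure.map_map hG (MeasurableEquiv.measurable _)]
    refine Eq.trans ?_ ((Measure.pi_map_pi fun j => (hgm j).aemeasurable).trans
      (congrArg _ (funext hgμ)))
    rfl
  have hkey : ∀ (q : ι → ℝ) (u : ι → I), P (fun j => f j (Function.update q i r j) (u j)) i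
      = P (fun j => g j (q j, u j)) i := fun q u => by
    congr 1
    ext j
    rcases eq_or_ne j i with rfl | h
    · simp [hg]
    · simp [hg, h]
  simp only [resampledAllocation, hkey]
  rw [← integral_prod (f := fun z : (ι → ℝ) × (ι → I) => P (fun j => g j (z.1 j, z.2 j)) i)
    (hPint _ _ hG), ← integral_map (f := fun θ => P θ i) hG.aemeasurable
    hPi.aestronglyMeasurable, hlaw, ← map_update_prod_pi,
    integral_map (measurable_update_uncurry i).aemeasurable hPi.aestronglyMeasurable,
    integral_prod _ (hPint _ _ (measurable_update_uncurry i))]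
  -- What remains is the mean of the interim allocation over types drawn from `f i r`, which is `r`
  -- because `r` is exact.
  exact (integral_map hfr.aemeasurable
    (measurable_interimAllocation (μ := μ) hP i).aestronglyMeasurable).trans hr

end Resampling

/-! ### Integrals and incentives in the model -/

namespace ContestModel

variable {n : ℕ} (M : ContestModel n)

instance (i : Fin n) : NullSingletonClass (M.typeDist i) := by
  unfold typeDist; infer_instance

instance : IsProbabilityMeasure M.profileDist := by
  unfold profileDist; infer_instance

lemma ae_mem_typeSpace (i : Fin n) : ∀ᵐ t ∂M.typeDist i, t ∈ M.typeSpace i :=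
  (withDensity_absolutelyContinuous _ _).ae_le (ae_restrict_mem measurableSet_Icc)

lemma typeDist_Iic_eq_zero (i : Fin n) {t : ℝ} (ht : t ≤ M.lo i) : M.typeDist i (Iic t) = 0 := by
  have h : ∀ᵐ s ∂M.typeDist i, s ∉ Iic t := by
    filter_upwards [M.ae_mem_typeSpace i, (measure_eq_zero_iff_ae_notMem.1
      (measure_singleton (μ := M.typeDist i) (M.lo i)))] with s hs hs' hst
    exact hs' (le_antisymm (le_trans hst ht) hs.1)
  exact measure_eq_zero_iff_ae_notMem.2 h

lemma integrable_of_monotoneOn (i : Fin n) {g : ℝ → ℝ} (hg : MonotoneOn g (M.typeSpace i)) :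
    Integrable g (M.typeDist i) := by
  rw [← Measure.restrict_eq_self_of_ae_mem (M.ae_mem_typeSpace i)]
  exact hg.integrableOn_isCompact isCompact_Icc

lemma integrable_id_mul (i : Fin n) {Q R : ℝ → ℝ} (hR : Measurable R)
    (hQR : ∀ t ∈ M.typeSpace i, Q t = R t) {c : ℝ} (hRc : ∀ t, |R t| ≤ c) :
    Integrable (fun t => t * Q t) (M.typeDist i) := by
  have hae : (fun t => t * R t) =ᵐ[M.typeDist i] fun t => t * Q t := by
    filter_upwards [M.ae_mem_typeSpace i] with t ht
    rw [hQR t ht]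
  refine Integrable.congr ?_ hae
  refine Integrable.of_bound (measurable_id'.mul hR).aestronglyMeasurable
    (max |M.lo i| |M.hi i| * c) ?_
  filter_upwards [M.ae_mem_typeSpace i] with t ht
  rw [norm_mul]
  exact mul_le_mul (abs_le_max_abs_abs ht.1 ht.2) (hRc t) (norm_nonneg _) (by positivity)

lemma integrable_sum_eval {g : Fin n → ℝ → ℝ} (hg : ∀ i, Integrable (g i) (M.typeDist i)) :
    Integrable (fun θ => ∑ i, g i (θ i)) M.profileDist :=
  integrable_finsetSum _ fun i _ => integrable_comp_eval (hg i)

lemma integral_sum_eval {g : Fin n → ℝ → ℝ} (hg : ∀ i, Integrable (g i) (M.typeDist i)) :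
    ∫ θ, ∑ i, g i (θ i) ∂M.profileDist = ∑ i, ∫ t, g i t ∂M.typeDist i := by
  rw [profileDist, integral_finsetSum _ fun i _ => integrable_comp_eval (hg i)]
  exact Finset.sum_congr rfl fun i _ => integral_comp_eval (hg i).aestronglyMeasurable

lemma objective_eq (α : ℝ) {Q U : Fin n → ℝ → ℝ}
    (hQ : ∀ i, Integrable (fun t => t * Q i t) (M.typeDist i))
    (hU : ∀ i, Integrable (U i) (M.typeDist i)) :
    M.objective α Q U
      = α * M.matchingEfficiency Q + (1 - α) * ∑ i, ∫ t, U i t ∂M.typeDist i := by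
  rw [objective, matchingEfficiency, integral_add ((M.integrable_sum_eval hQ).const_mul α)
    ((M.integrable_sum_eval hU).const_mul (1 - α)), integral_const_mul, integral_const_mul,
    M.integral_sum_eval hU]

lemma effort_le_add (s : ℝ≥0) (t t' : ℝ) : effort s t ≤ effort s t' + max 0 (t' - t) := by
  unfold effort
  have h1 := le_max_left 0 ((s : ℝ) - t')
  have h2 := le_max_right 0 ((s : ℝ) - t')
  have h3 := le_max_left 0 (t' - t)
  have h4 := le_max_right 0 (t' - t)
  exact max_le (by linarith) (by linarith)

lemma effort_nonneg (s : ℝ≥0) (t : ℝ) : 0 ≤ effort s t := le_max_left _ _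

lemma measurable_effort {α : Type*} [MeasurableSpace α] {g : α → ℝ≥0} (hg : Measurable g) (t : ℝ) :
    Measurable fun a => effort (g a) t := by
  unfold effort; fun_prop

/-- Interim utilities that satisfy the incentive constraints of a general mechanism are
nondecreasing and `η`-Lipschitz. -/
lemma utility_le_add {ρ : Kernel (Fin n → ℝ) (Fin n → ℝ≥0)} [IsMarkovKernel ρ]
    {p : (Fin n → ℝ) → (Fin n → ℝ≥0) → (Fin n → ℝ)}
    (hp : Measurable (fun z : (Fin n → ℝ) × (Fin n → ℝ≥0) => p z.1 z.2))
    (hpX : ∀ θ s, p θ s ∈ M.allocations) (i : Fin n) (t t' : ℝ)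
    (hfin : ∫⁻ θ, ∫⁻ s, ENNReal.ofReal (effort (s i) t') ∂(ρ (Function.update θ i t'))
      ∂M.profileDist ≠ ⊤) :
    ∫ θ, ∫ s, p (Function.update θ i t') s i ∂(ρ (Function.update θ i t')) ∂M.profileDist
      - M.η * (∫⁻ θ, ∫⁻ s, ENNReal.ofReal (effort (s i) t') ∂(ρ (Function.update θ i t'))
          ∂M.profileDist).toReal
      ≤ ∫ θ, ∫ s, max 0 (p (Function.update θ i t') s i - M.η * effort (s i) t)
          ∂(ρ (Function.update θ i t')) ∂M.profileDist + M.η * max 0 (t' - t) := by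
  have hup : Measurable fun θ : Fin n → ℝ => Function.update θ i t' := measurable_update_left
  set κ : Kernel (Fin n → ℝ) (Fin n → ℝ≥0) := ρ.comap _ hup
  set m := M.profileDist ⊗ₘ κ
  have ham : Measurable fun z : (Fin n → ℝ) × (Fin n → ℝ≥0) =>
      p (Function.update z.1 i t') z.2 i :=
    (measurable_pi_apply i).comp (hp.comp ((hup.comp measurable_fst).prodMk measurable_snd))
  have hsm : Measurable fun z : (Fin n → ℝ) × (Fin n → ℝ≥0) => z.2 i := by fun_prop
  have hem := fun r => measurable_effort hsm r
  have hai : Integrable (fun z : (Fin n → ℝ) × (Fin n → ℝ≥0) =>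
      p (Function.update z.1 i t') z.2 i) m :=
    Integrable.of_bound ham.aestronglyMeasurable 1 (ae_of_all _ fun z => by
      rw [Real.norm_of_nonneg ((hpX _ _).1 i).1]; exact ((hpX _ _).1 i).2)
  have hl : ∫⁻ z, ENNReal.ofReal (effort (z.2 i) t') ∂m
      = ∫⁻ θ, ∫⁻ s, ENNReal.ofReal (effort (s i) t') ∂(ρ (Function.update θ i t'))
          ∂M.profileDist :=
    Measure.lintegral_compProd (hem t').ennreal_ofReal
  have hei : Integrable (fun z : (Fin n → ℝ) × (Fin n → ℝ≥0) => effort (z.2 i) t') m := by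
    refine ⟨(hem t').aestronglyMeasurable, ?_⟩
    rw [hasFiniteIntegral_iff_ofReal (ae_of_all _ fun z => effort_nonneg _ _), hl]
    exact hfin.lt_top
  have hmaxi : Integrable (fun z : (Fin n → ℝ) × (Fin n → ℝ≥0) =>
      max 0 (p (Function.update z.1 i t') z.2 i - M.η * effort (z.2 i) t)) m := by
    refine Integrable.of_bound (measurable_const.max
      (ham.sub ((hem t).const_mul M.η))).aestronglyMeasurable 1 (ae_of_all _ fun z => ?_)
    rw [Real.norm_of_nonneg (le_max_left _ _)]
    have h1 := ((hpX (Function.update z.1 i t') z.2).1 i).2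
    have h2 := mul_nonneg M.η_pos.le (effort_nonneg (z.2 i) t)
    exact max_le zero_le_one (by linarith)
  have e1 : ∫ θ, ∫ s, p (Function.update θ i t') s i ∂(ρ (Function.update θ i t')) ∂M.profileDist
      = ∫ z, p (Function.update z.1 i t') z.2 i ∂m := (Measure.integral_compProd hai).symm
  have e2 : ∫ θ, ∫ s, max 0 (p (Function.update θ i t') s i - M.η * effort (s i) t)
          ∂(ρ (Function.update θ i t')) ∂M.profileDist
      = ∫ z, max 0 (p (Function.update z.1 i t') z.2 i - M.η * effort (z.2 i) t) ∂m :=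
    (Measure.integral_compProd hmaxi).symm
  rw [← hl, e1, e2, ← integral_eq_lintegral_of_nonneg_ae
    (ae_of_all _ fun z => effort_nonneg _ _) hei.aestronglyMeasurable, ← integral_const_mul,
    ← integral_sub hai (hei.const_mul _), ← sub_le_iff_le_add]
  have hconst : M.η * max 0 (t' - t) = ∫ _, M.η * max 0 (t' - t) ∂m := by simp
  have hdi : Integrable (fun z : (Fin n → ℝ) × (Fin n → ℝ≥0) =>
      p (Function.update z.1 i t') z.2 i - M.η * effort (z.2 i) t') m := hai.sub (hei.const_mul _)
  rw [hconst, ← integral_sub hdi (integrable_const _)]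
  refine integral_mono (hdi.sub (integrable_const _)) hmaxi fun z => ?_
  -- Pointwise, obeying the recommendation is one of the two options inside the maximum.
  refine le_trans ?_ (le_max_right _ _)
  have := mul_le_mul_of_nonneg_left (effort_le_add (z.2 i) t t') M.η_pos.le
  linarith

end ContestModel

/-! ### Construction of the contest -/

theorem mainTheorem1 {n : ℕ} (M : ContestModel n) (Q U : Fin n → ℝ → ℝ)
    (h : M.ImplementableByGeneral Q U) :
    ∃ Q' U' : Fin n → ℝ → ℝ,
      (∀ i, MonotoneOn (Q' i) (M.typeSpace i)) ∧
      M.ImplementableByContest Q' U' ∧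
      M.matchingEfficiency Q ≤ M.matchingEfficiency Q' ∧
      (∀ i, ∀ t ∈ M.typeSpace i, U i t ≤ U' i t) ∧
      ∀ α ∈ Set.Icc (0 : ℝ) 1, M.objective α Q U ≤ M.objective α Q' U' := by
  obtain ⟨ρ, p, hρ, hp, hpX, hQ, hU, hIC⟩ := h
  have hη := M.η_pos
  have hk : (0 : ℝ) ≤ M.k := Nat.cast_nonneg _
  -- Bounds any single agent's winning probability, also when `k = 0`; giving one agent `c` and the
  -- others nothing is feasible.
  set c : ℝ := min 1 (M.k : ℝ)
  have hc0 : 0 ≤ c := le_min zero_le_one hk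
  -- the ex post allocation, averaged over signals
  set P : (Fin n → ℝ) → Fin n → ℝ := fun θ i => ∫ s, p θ s i ∂(ρ θ) with hPdef
  have hpi : ∀ θ i, Integrable (fun s => p θ s i) (ρ θ) := fun θ i =>
    Integrable.of_bound ((measurable_pi_apply i).comp
      (hp.comp measurable_prodMk_left)).aestronglyMeasurable 1 (ae_of_all _ fun s => by
        rw [Real.norm_of_nonneg ((hpX _ _).1 i).1]; exact ((hpX _ _).1 i).2)
  have hPm : Measurable P := measurable_pi_lambda _ fun i =>
    (((measurable_pi_apply i).comp hp).stronglyMeasurable.integral_kernel_prod_right'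
      (κ := ρ)).measurable
  have hP0 : ∀ θ i, 0 ≤ P θ i := fun θ i => integral_nonneg fun s => ((hpX θ s).1 i).1
  have hP1 : ∀ θ i, P θ i ≤ 1 := fun θ i =>
    (integral_mono (hpi θ i) (integrable_const 1) fun s => ((hpX θ s).1 i).2).trans (by simp)
  have hPs : ∀ θ, ∑ i, P θ i ≤ M.k := fun θ => by
    simp only [hPdef]
    rw [← integral_finsetSum _ fun i _ => hpi θ i]
    exact (integral_mono (integrable_finsetSum _ fun i _ => hpi θ i)
      (integrable_const (M.k : ℝ)) fun s => (hpX θ s).2).trans (by simp)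
  have hPc : ∀ θ i, P θ i ≤ c := fun θ i => le_min (hP1 θ i)
    ((Finset.single_le_sum (fun j _ => hP0 θ j) (Finset.mem_univ i)).trans (hPs θ))
  set Qt : Fin n → ℝ → ℝ := interimAllocation M.typeDist P
  have hQtm : ∀ i, Measurable (Qt i) := fun i => measurable_interimAllocation hPm i
  have hQQt : ∀ i, ∀ t ∈ M.typeSpace i, Q i t = Qt i t := hQ
  have hQt0 : ∀ i t, 0 ≤ Qt i t := fun i t => integral_nonneg fun θ => hP0 _ _
  have hQtc : ∀ i t, Qt i t ≤ c := fun i t => by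
    refine (integral_mono (Integrable.of_bound ((measurable_pi_apply i).comp
      (hPm.comp measurable_update_left)).aestronglyMeasurable c (ae_of_all _ fun θ => ?_))
      (integrable_const c) fun θ => hPc _ _).trans (by simp)
    exact (Real.norm_of_nonneg (hP0 _ _)).trans_le (hPc _ _)
  have hULip : ∀ i, ∀ s ∈ M.typeSpace i, ∀ t ∈ M.typeSpace i,
      U i s ≤ U i t + M.η * max 0 (s - t) := fun i s hs t ht => by
    have h1 := M.utility_le_add hp hpX i t s (hU i s hs).1
    rw [← hQ i s hs, ← (hU i s hs).2] at h1
    linarith [hIC i t ht s hs]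
  have hUmono : ∀ i, MonotoneOn (U i) (M.typeSpace i) := fun i s hs t ht hst => by
    simpa [max_eq_left (sub_nonpos.2 hst)] using hULip i s hs t ht
  have hUQ : ∀ i, ∀ t ∈ M.typeSpace i, U i t ≤ Qt i t := fun i t ht => by
    rw [(hU i t ht).2, hQQt i t ht]
    exact sub_le_self _ (mul_nonneg hη.le ENNReal.toReal_nonneg)
  -- the rearranged allocation, the utilities and the strategies
  set R : Fin n → ℝ → ℝ := fun i => increasingRearrangement (M.typeDist i) (Qt i) c
  have hRmono : ∀ i, Monotone (R i) := fun i => monotone_increasingRearrangement hc0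
  have hR0 : ∀ i t, 0 ≤ R i t := fun i t => increasingRearrangement_nonneg hc0 t
  have hRc : ∀ i t, R i t ≤ c := fun i t => increasingRearrangement_le hc0 t
  have hRabs : ∀ i t, |R i t| ≤ c := fun i t => by rw [abs_of_nonneg (hR0 i t)]; exact hRc i t
  have hRmap : ∀ i, (M.typeDist i).map (R i) = (M.typeDist i).map (Qt i) := fun i =>
    map_increasingRearrangement (hQtm i) (hQt0 i) (hQtc i)
  set V : Fin n → ℝ → ℝ := fun i => lipschitzMinorant M.η (R i)
  have hVmono : ∀ i, Monotone (V i) := fun i => monotone_lipschitzMinorant hη.le (hR0 i)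
  have hVR : ∀ i t, V i t ≤ R i t := fun i t => lipschitzMinorant_le hη.le (hR0 i) t
  have hUV : ∀ i, ∀ t ∈ M.typeSpace i, U i t ≤ V i t := fun i t ht =>
    le_lipschitzMinorant hη.le (hRmono i) (hULip i)
      (fun s hs => le_increasingRearrangement (M.ae_mem_typeSpace i) (hUmono i) (hUQ i)
        (hQtc i) hs)
      (fun s hs => (increasingRearrangement_of_measure_Iic_eq
        ((M.typeDist_Iic_eq_zero i le_rfl).trans (M.typeDist_Iic_eq_zero i hs).symm)).le) ht
  -- The effort `(R i t - V i t) / η` costs exactly the gap between allocation and utility.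
  -- Truncation to `ℝ≥0` is void on types, which are nonnegative.
  set sig : Fin n → ℝ → ℝ≥0 := fun i t => Real.toNNReal (t + (R i t - V i t) / M.η)
  have hsigm : ∀ i, Measurable (sig i) := fun i => by
    have h1 := (hRmono i).measurable
    have h2 := (hVmono i).measurable
    exact Measurable.real_toNNReal (by fun_prop)
  have hsigc : ∀ i, ∀ t ∈ M.typeSpace i, (sig i t : ℝ) = t + (R i t - V i t) / M.η :=
    fun i t ht => Real.coe_toNNReal _ (add_nonneg ((M.lo_nonneg i).trans ht.1)
      (div_nonneg (sub_nonneg.2 (hVR i t)) hη.le))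
  have hVsig : ∀ i, ∀ t ∈ M.typeSpace i, V i (sig i t) = R i t := fun i t ht => by
    rw [hsigc i t ht]
    exact lipschitzMinorant_add_div hη (hR0 i) (hRmono i) t
  choose f hfm hfQ using fun i => exists_conditional_sampler (M.typeDist i) (hQtm i)
  set x : (Fin n → ℝ≥0) → (Fin n → ℝ) := fun s =>
    correctedAllocation M.typeDist P f c (fun j => V j (s j)) with hx
  have hCm := measurable_correctedAllocation (μ := M.typeDist) hPm hfm c
  have hxm : Measurable x := hCm.comp (measurable_pi_lambda _ fun j =>
    (hVmono j).measurable.comp (measurable_coe_nnreal_real.comp (measurable_pi_apply j)))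
  -- Needed for every signal `s`, including those no type sends, since deviations are evaluated
  -- there too.
  have hxint : ∀ i (s : ℝ≥0),
      ∫ θ, x (Function.update (fun j => sig j (θ j)) i s) i ∂M.profileDist = V i s := by
    intro i s
    have hae : ∀ᵐ θ ∂M.profileDist, x (Function.update (fun j => sig j (θ j)) i s) i
        = correctedAllocation M.typeDist P f c
            (Function.update (fun j => R j (θ j)) i (V i s)) i := by
      have hmem : ∀ᵐ θ ∂M.profileDist, ∀ j, θ j ∈ M.typeSpace j := by
        rw [ae_all_iff]
        exact fun j => (measurePreserving_eval M.typeDist j).quasiMeasurePreserving.ae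
          (M.ae_mem_typeSpace j)
      filter_upwards [hmem] with θ hθ
      simp only [hx]
      congr 1
      ext j
      rcases eq_or_ne j i with rfl | hj
      · simp
      · simp [hj, hVsig j _ (hθ j)]
    have hprob : ∀ j, IsProbabilityMeasure ((M.typeDist j).map (R j)) := fun j =>
      Measure.isProbabilityMeasure_map (hRmono j).measurable.aemeasurable
    have hlaw : M.profileDist.map (fun θ j => R j (θ j))
        = Measure.pi fun j => (M.typeDist j).map (Qt j) :=
      (Measure.pi_map_pi fun j => (hRmono j).measurable.aemeasurable).trans
        (congrArg _ (funext hRmap))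
    rw [integral_congr_ae hae, ← integral_map (φ := fun (θ : Fin n → ℝ) j => R j (θ j))
      (f := fun q => correctedAllocation M.typeDist P f c (Function.update q i (V i s)) i)
      (measurable_pi_lambda _ fun j =>
        (hRmono j).measurable.comp (measurable_pi_apply j)).aemeasurable
      ((measurable_pi_apply i).comp (hCm.comp measurable_update_left)).aestronglyMeasurable, hlaw]
    exact integral_correctedAllocation hPm hfm hP0 hP1 hfQ
      (lipschitzMinorant_nonneg hη.le (hR0 i) _) ((hVR i _).trans (hRc i _)) i
  have hQint : ∀ i, Integrable (fun t => t * Q i t) (M.typeDist i) := fun i =>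
    M.integrable_id_mul i (hQtm i) (hQQt i) fun t => by
      rw [abs_of_nonneg (hQt0 i t)]; exact hQtc i t
  have hRint : ∀ i, Integrable (fun t => t * R i t) (M.typeDist i) := fun i =>
    M.integrable_id_mul i (hRmono i).measurable (fun _ _ => rfl) (hRabs i)
  have hUint : ∀ i, Integrable (U i) (M.typeDist i) := fun i =>
    M.integrable_of_monotoneOn i (hUmono i)
  have hVint : ∀ i, Integrable (V i) (M.typeDist i) := fun i =>
    M.integrable_of_monotoneOn i ((hVmono i).monotoneOn _)
  have heff : M.matchingEfficiency Q ≤ M.matchingEfficiency R := by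
    rw [ContestModel.matchingEfficiency, ContestModel.matchingEfficiency,
      M.integral_sum_eval hQint, M.integral_sum_eval hRint]
    refine Finset.sum_le_sum fun i _ => ?_
    have hQQ : ∫ t, t * Q i t ∂M.typeDist i = ∫ t, t * Qt i t ∂M.typeDist i := by
      refine integral_congr_ae ?_
      filter_upwards [M.ae_mem_typeSpace i] with t ht
      rw [hQQt i t ht]
    rw [hQQ]
    exact integral_mul_le_integral_mul_of_monotone (hQtm i) (hRmono i) (hRabs i) (hRmap i)
      (M.ae_mem_typeSpace i)
  refine ⟨R, V, fun i => (hRmono i).monotoneOn _, ⟨x, sig, hxm, fun s =>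
    correctedAllocation_mem hk hPm hfm hP0 hP1 hPs _, hsigm, fun i t ht => ?_, fun i t ht => ?_,
    fun i t ht s' => ?_⟩, heff, hUV, fun α hα => ?_⟩
  · rw [hxint, hVsig i t ht]
  · have hd : 0 ≤ (R i t - V i t) / M.η := div_nonneg (sub_nonneg.2 (hVR i t)) hη.le
    rw [ContestModel.effort, hsigc i t ht, add_sub_cancel_left, max_eq_right hd,
      mul_div_cancel₀ _ hη.ne', sub_sub_cancel]
  · rw [hxint, sub_le_iff_le_add]
    exact lipschitzMinorant_le_add hη.le (hR0 i) s' t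
  · rw [M.objective_eq α hQint hUint, M.objective_eq α hRint hVint]
    refine add_le_add (mul_le_mul_of_nonneg_left heff hα.1)
      (mul_le_mul_of_nonneg_left (Finset.sum_le_sum fun i _ => ?_) (sub_nonneg.2 hα.2))
    refine integral_mono_ae (hUint i) (hVint i) ?_
    filter_upwards [M.ae_mem_typeSpace i] with t ht using hUV i t ht
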